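/- For an integer $q\ge 1$ let $T_q$ be the set of triples $(a,b,c)\in\mathbb Z\times\mathbb Z\times\mathbb N$ with $c>0$ and $a^2+qb^2=c^2$. Call $(a,b,c)$ and $(A,B,C)$ in $T_q$ equivalent if there are non-zero integers $m,n$ with $ma=nA$, $mb=nB$ and $|mc|=|nC|$, and let ${\cal P}_q$ be the set of equivalence classes $[a,b,c]$ (each class contains a primitive triple), an abelian group under $$[a,b,c]+[A,B,C]=[aA-qbB,\;aB+bA,\;cC],$$ with identity $[1,0,1]$ and $-[a,b,c]=[a,-b,c]$. (1) For every square-free integer $q$ with $q=2$ or $q>3$, the group ${\cal P}_q$ is torsion-free; moreover, it is a free abelian group. (2) The torsion subgroup of ${\cal P}_3$ is the subgroup $\langle[1,1,2]\rangle$ generated by $[1,1,2]$, which is cyclic of order $3$, and there is a free abelian subgroup ${\cal F}_3\subset{\cal P}_3$ such that ${\cal P}_3={\cal F}_3\oplus\langle[1,1,2]\rangle$; in particular ${\cal P}_3\cong{\cal F}_3\oplus\mathbb Z/3\mathbb Z$. -/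

import Mathlib

/-- An almost Pythagorean triple for `q`: integers `a`, `b` and a positive natural number `c`
with `a ^ 2 + q * b ^ 2 = c ^ 2`. -/
@[ext]
structure APTriple (q : ℕ) where
  a : ℤ
  b : ℤ
  c : ℕ
  c_pos : 0 < c
  eqn : a ^ 2 + (q : ℤ) * b ^ 2 = (c : ℤ) ^ 2

namespace APTriple

/-- Projectivization: `m (a, b, c) = n (A, B, C)` for some non-zero integers `m`, `n`, where
`m (a, b, c)` stands for `(m a, m b, |m c|)`. -/
def Equivalent {q : ℕ} (s t : APTriple q) : Prop :=
  ∃ m n : ℤ, m ≠ 0 ∧ n ≠ 0 ∧ m * s.a = n * t.a ∧ m * s.b = n * t.b ∧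
    |m * (s.c : ℤ)| = |n * (t.c : ℤ)|

theorem equivalent_equivalence (q : ℕ) : Equivalence (@Equivalent q) where
  refl s := ⟨1, 1, one_ne_zero, one_ne_zero, rfl, rfl, rfl⟩
  symm := by
    rintro s t ⟨m, n, hm, hn, h1, h2, h3⟩
    exact ⟨n, m, hn, hm, h1.symm, h2.symm, h3.symm⟩
  trans := by
    rintro s t u ⟨m, n, hm, hn, h1, h2, h3⟩ ⟨m', n', hm', hn', h1', h2', h3'⟩
    refine ⟨m' * m, n * n', mul_ne_zero hm' hm, mul_ne_zero hn hn', ?_, ?_, ?_⟩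
    · linear_combination m' * h1 + n * h1'
    · linear_combination m' * h2 + n * h2'
    · rw [mul_assoc, abs_mul, h3, ← abs_mul, mul_assoc, abs_mul n, ← h3', ← abs_mul]
      congr 1
      ring

/-- The setoid of projectivization. -/
instance setoid (q : ℕ) : Setoid (APTriple q) := ⟨Equivalent, equivalent_equivalence q⟩

/-- The triple `(a A - q b B, a B + b A, c C)`. -/
def add {q : ℕ} (s t : APTriple q) : APTriple q where
  a := s.a * t.a - (q : ℤ) * s.b * t.b
  b := s.a * t.b + s.b * t.a
  c := s.c * t.c
  c_pos := Nat.mul_pos s.c_pos t.c_pos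
  eqn := by
    push_cast
    rw [mul_pow, ← s.eqn, ← t.eqn]
    ring

/-- The triple `(a, -b, c)`. -/
def neg {q : ℕ} (s : APTriple q) : APTriple q where
  a := s.a
  b := -s.b
  c := s.c
  c_pos := s.c_pos
  eqn := by rw [neg_sq, s.eqn]

/-- The triple `(1, 0, 1)`. -/
def one (q : ℕ) : APTriple q := ⟨1, 0, 1, one_pos, by norm_num⟩

end APTriple

/-- The set `P_q` of equivalence classes `[a, b, c]` of almost Pythagorean triples. -/
def PAPT (q : ℕ) : Type := Quotient (APTriple.setoid q)

namespace PAPT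

/-- The class `[a, b, c]`. -/
def mk {q : ℕ} (s : APTriple q) : PAPT q := Quotient.mk _ s

/-- `[a, b, c] + [A, B, C] = [a A - q b B, a B + b A, c C]`. -/
instance (q : ℕ) : Add (PAPT q) where
  add := Quotient.map₂ APTriple.add (by
    rintro s s' ⟨m, n, hm, hn, h1, h2, h3⟩ t t' ⟨m', n', hm', hn', h1', h2', h3'⟩
    refine ⟨m * m', n * n', mul_ne_zero hm hm', mul_ne_zero hn hn', ?_, ?_, ?_⟩
    · simp only [APTriple.add]
      linear_combination (m' * t.a) * h1 + (n * s'.a) * h1'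
        - (q : ℤ) * (m' * t.b) * h2 - (q : ℤ) * (n * s'.b) * h2'
    · simp only [APTriple.add]
      linear_combination (m' * t.b) * h1 + (n * s'.a) * h2'
        + (m' * t.a) * h2 + (n * s'.b) * h1'
    · simp only [APTriple.add, Nat.cast_mul]
      rw [mul_mul_mul_comm, abs_mul, h3, h3', ← abs_mul, mul_mul_mul_comm])

/-- The identity element is `[1, 0, 1]`. -/
instance (q : ℕ) : Zero (PAPT q) := ⟨mk (APTriple.one q)⟩

/-- The inverse of `[a, b, c]` is `[a, -b, c]`. -/
instance (q : ℕ) : Neg (PAPT q) where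
  neg := Quotient.map APTriple.neg (by
    rintro s t ⟨m, n, hm, hn, h1, h2, h3⟩
    refine ⟨m, n, hm, hn, h1, ?_, h3⟩
    simp only [APTriple.neg]
    linear_combination -h2)

theorem mk_add_mk {q : ℕ} (s t : APTriple q) : mk s + mk t = mk (s.add t) := rfl

theorem neg_mk {q : ℕ} (s : APTriple q) : -mk s = mk s.neg := rfl

theorem zero_def (q : ℕ) : (0 : PAPT q) = mk (APTriple.one q) := rfl

theorem ind {q : ℕ} {p : PAPT q → Prop} (h : ∀ s, p (mk s)) (x : PAPT q) : p x :=
  Quotient.inductionOn x h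

theorem mk_eq_mk {q : ℕ} {s t : APTriple q} : mk s = mk t ↔ APTriple.Equivalent s t :=
  Quotient.eq

instance (q : ℕ) : AddCommGroup (PAPT q) where
  add_assoc x y z := by
    induction x using ind with | h s
    induction y using ind with | h t
    induction z using ind with | h u
    simp only [mk_add_mk]
    congr 1
    ext <;> simp only [APTriple.add] <;> ring
  zero_add x := by
    induction x using ind with | h s
    rw [zero_def, mk_add_mk]
    congr 1
    ext <;> simp [APTriple.add, APTriple.one]
  add_zero x := by
    induction x using ind with | h s
    rw [zero_def, mk_add_mk]
    congr 1
    ext <;> simp [APTriple.add, APTriple.one]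
  add_comm x y := by
    induction x using ind with | h s
    induction y using ind with | h t
    simp only [mk_add_mk]
    congr 1
    ext <;> simp only [APTriple.add] <;> ring
  nsmul := nsmulRec
  zsmul := zsmulRec
  neg_add_cancel x := by
    induction x using ind with | h s
    rw [neg_mk, mk_add_mk, zero_def, mk_eq_mk]
    refine ⟨1, (s.c : ℤ) ^ 2, one_ne_zero, pow_ne_zero 2 (by exact_mod_cast s.c_pos.ne'), ?_, ?_, ?_⟩
    · simp only [APTriple.add, APTriple.neg, APTriple.one]
      linear_combination s.eqn
    · simp only [APTriple.add, APTriple.neg, APTriple.one]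
      ring
    · simp only [APTriple.add, APTriple.neg, APTriple.one, Nat.cast_mul, Nat.cast_one]
      congr 1
      ring

/-- The class `[1, 1, 2]` for `q = 3`. -/
def omega : PAPT 3 := mk ⟨1, 1, 2, two_pos, by norm_num⟩

end PAPT

/-! Send [a, b, c] to the divisor of (a + b√-q)/c in the ring of integers of a number field
containing √-q. This is a homomorphism to a free abelian group. In its kernel both the element and
its inverse (a - b√-q)/c are integral, so their sum k = 2a/c is an integer, and q(2b)² = (4 - k²)c²
leaves |k| ≤ 2. For square-free q ≠ 1, k = 0 is impossible, k = ±1 forces q = 3, and k = ±2 forces b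
= 0. Hence the kernel is trivial for q ≠ 3 and is ⟨[1,1,2]⟩ for q = 3. The image is free, as a
subgroup of a free abelian group, so the map onto it splits; torsion dies in the target, so it lies
in the kernel. -/

/-- A subgroup of a free abelian group is free. -/
theorem Finsupp.free_submodule_int {ι : Type*} (N : Submodule ℤ (ι →₀ ℤ)) :
    Module.Free ℤ N := by
  classical
  obtain ⟨_, _⟩ := exists_wellFoundedLT ι
  -- Well-order the basis: `S i` is the part of `N` supported up to `i`, and `I i` its ideal of
  -- leading coefficients, which is principal.
  let S (i : ι) : Submodule ℤ (ι →₀ ℤ) := N ⊓ Finsupp.supported ℤ ℤ (Set.Iic i)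
  let I (i : ι) : Submodule ℤ ℤ := (S i).map (Finsupp.lapply i)
  have hgen (i : ι) : ∃ f ∈ S i, ∀ g ∈ S i, ∃ c : ℤ, g i = c * f i := by
    obtain ⟨d, hd⟩ := (IsPrincipalIdealRing.principal (I i)).principal
    have hd' : d ∈ I i := hd ▸ Submodule.mem_span_singleton_self d
    obtain ⟨f, hf, rfl⟩ := hd'
    refine ⟨f, hf, fun g hg => ?_⟩
    have : g i ∈ I i := ⟨g, hg, rfl⟩
    rw [hd] at this
    obtain ⟨c, hc⟩ := Submodule.mem_span_singleton.1 this
    exact ⟨c, hc.symm⟩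
  choose b hbS hb using hgen
  let J := {i : ι // b i i ≠ 0}
  let v (j : J) : N := ⟨b j, (hbS j).1⟩
  have hzero (i k : ι) (h : i < k) : b i k = 0 := by
    by_contra hk
    exact absurd ((hbS i).2 (Finsupp.mem_support_iff.2 hk)) (not_le.2 h)
  have hli : LinearIndependent ℤ v := by
    rw [linearIndependent_iff]
    intro l hl
    by_contra hne
    have hs : l.support.Nonempty := Finsupp.support_nonempty_iff.2 hne
    set m := l.support.max' hs with hm
    have hlm : l m ≠ 0 := Finsupp.mem_support_iff.1 (Finset.max'_mem _ hs)
    have h0 := congrArg (fun x : N => (x : ι →₀ ℤ) m) hl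
    simp only [Finsupp.linearCombination_apply, Finsupp.sum, Submodule.coe_sum,
      Finsupp.finsetSum_apply, ZeroMemClass.coe_zero, Finsupp.coe_zero, Pi.zero_apply] at h0
    rw [Finset.sum_eq_single m] at h0
    · exact (mul_ne_zero hlm m.2) h0
    · intro j hj hjm
      have : j < m := lt_of_le_of_ne (Finset.le_max' _ _ hj) hjm
      change l j * b j m = 0
      rw [hzero j m this, mul_zero]
    · intro h
      exact absurd (Finset.max'_mem _ hs) h
  have hspan (i : ι) : ∀ f : N, (f : ι →₀ ℤ) ∈ S i → f ∈ Submodule.span ℤ (Set.range v) := by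
    induction i using WellFoundedLT.induction with
    | ind i ih =>
    intro f hf
    obtain ⟨c, hc⟩ := hb i f hf
    have key (g : N) (hg : (g : ι →₀ ℤ) ∈ S i) (hgi : (g : ι →₀ ℤ) i = 0) :
        g ∈ Submodule.span ℤ (Set.range v) := by
      by_cases hg0 : g = 0
      · rw [hg0]; exact zero_mem _
      have hs : (g : ι →₀ ℤ).support.Nonempty :=
        Finsupp.support_nonempty_iff.2 (by simpa using hg0)
      have hmem := Finset.max'_mem _ hs
      -- As `g` vanishes at `i`, its largest support index is below `i`.
      refine ih _ (lt_of_le_of_ne (hg.2 hmem) ?_) g ⟨g.2, fun k hk => Finset.le_max' _ _ hk⟩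
      intro h
      rw [h] at hmem
      exact Finsupp.mem_support_iff.1 hmem hgi
    by_cases hbi : b i i = 0
    · exact key f hf (by rw [hc, hbi, mul_zero])
    · have hv : v ⟨i, hbi⟩ ∈ Submodule.span ℤ (Set.range v) := Submodule.subset_span ⟨_, rfl⟩
      have h1 := key (f - c • v ⟨i, hbi⟩)
        ((S i).sub_mem hf ((S i).smul_mem c (hbS i))) (by
          change (f : ι →₀ ℤ) i - c * b i i = 0
          rw [hc, sub_self])
      rw [← sub_add_cancel f (c • v ⟨i, hbi⟩)]
      exact add_mem h1 (Submodule.smul_mem _ c hv)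
  refine Module.Free.of_basis (Module.Basis.mk hli fun f _ => ?_)
  by_cases hf0 : f = 0
  · rw [hf0]; exact zero_mem _
  have hs : (f : ι →₀ ℤ).support.Nonempty :=
    Finsupp.support_nonempty_iff.2 (by simpa using hf0)
  exact hspan ((f : ι →₀ ℤ).support.max' hs) f ⟨f.2, fun k hk => Finset.le_max' _ _ hk⟩

/-! ### Divisors in a Dedekind domain -/

open IsDedekindDomain nonZeroDivisors

namespace IsDedekindDomain

variable (R : Type*) {K : Type*} [CommRing R] [IsDedekindDomain R] [Field K] [Algebra R K]
  [IsFractionRing R K]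

/-- The exponents of the primes of a Dedekind domain in the principal fractional ideal `(x)`. -/
noncomputable def divisor (x : K) : HeightOneSpectrum R →₀ ℤ :=
  Finsupp.ofSupportFinite
    (fun v => FractionalIdeal.count K v (FractionalIdeal.spanSingleton R⁰ x))
    (FractionalIdeal.finite_factors (FractionalIdeal.spanSingleton R⁰ x))

theorem divisor_apply (x : K) (v : HeightOneSpectrum R) :
    divisor R x v = FractionalIdeal.count K v (FractionalIdeal.spanSingleton R⁰ x) := rfl

theorem divisor_mul {x y : K} (hx : x ≠ 0) (hy : y ≠ 0) :
    divisor R (x * y) = divisor R x + divisor R y := by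
  ext v
  rw [Finsupp.add_apply, divisor_apply, divisor_apply, divisor_apply,
    ← FractionalIdeal.spanSingleton_mul_spanSingleton]
  exact FractionalIdeal.count_mul K v (FractionalIdeal.spanSingleton_ne_zero_iff.2 hx)
    (FractionalIdeal.spanSingleton_ne_zero_iff.2 hy)

/-- Doubling is injective on divisors. This absorbs the sign ambiguity of the field element attached
to a class. -/
theorem divisor_eq_of_sq_eq_sq {x y : K} (hx : x ≠ 0) (hy : y ≠ 0) (h : x ^ 2 = y ^ 2) :
    divisor R x = divisor R y := by
  have h2 := congrArg (divisor R) h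
  rw [sq, sq, divisor_mul R hx hx, divisor_mul R hy hy] at h2
  ext v
  have := DFunLike.congr_fun h2 v
  simp only [Finsupp.add_apply] at this
  lia

theorem mem_range_algebraMap_of_divisor_eq_zero {x : K} (hx : x ≠ 0) (h : divisor R x = 0) :
    x ∈ Set.range (algebraMap R K) := by
  have h1 := FractionalIdeal.finprod_heightOneSpectrum_factorization' (R := R) K
    (FractionalIdeal.spanSingleton_ne_zero_iff.2 hx)
  simp only [← divisor_apply, h, Finsupp.coe_zero, Pi.zero_apply, zpow_zero, finprod_one] at h1
  have h2 := FractionalIdeal.mem_spanSingleton_self R⁰ x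
  rw [← h1] at h2
  obtain ⟨y, hy⟩ := (FractionalIdeal.mem_one_iff R⁰).1 h2
  exact ⟨y, hy⟩

end IsDedekindDomain

/-! ### Triples as norm one elements -/

open IsDedekindDomain

namespace APTriple

variable {q : ℕ} {K : Type*} [Field K]

/-- The norm one element `(a + b √(-q)) / c` attached to a triple, where `s = √(-q)`. -/
noncomputable def toField (s : K) (t : APTriple q) : K := (t.a + t.b * s) / t.c

variable [CharZero K]

theorem cast_c_ne_zero (t : APTriple q) : (t.c : K) ≠ 0 := Nat.cast_ne_zero.2 t.c_pos.ne'

theorem cast_eqn (t : APTriple q) : (t.a : K) ^ 2 + q * t.b ^ 2 = t.c ^ 2 := by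
  exact_mod_cast congrArg (Int.cast : ℤ → K) t.eqn

variable {s : K} (hs : s ^ 2 = -q)

include hs

theorem toField_mul_toField_neg (t : APTriple q) : t.toField s * t.neg.toField s = 1 := by
  have hc := t.cast_c_ne_zero (K := K)
  have he := t.cast_eqn (K := K)
  simp only [toField, neg, Int.cast_neg]
  field_simp
  linear_combination he - (t.b : K) ^ 2 * hs

theorem toField_ne_zero (t : APTriple q) : t.toField s ≠ 0 :=
  left_ne_zero_of_mul_eq_one (t.toField_mul_toField_neg hs)

theorem toField_add (t u : APTriple q) : (t.add u).toField s = t.toField s * u.toField s := by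
  have hc := t.cast_c_ne_zero (K := K)
  have hc' := u.cast_c_ne_zero (K := K)
  simp only [toField, add]
  push_cast
  field_simp
  linear_combination -(t.b * u.b : K) * hs

-- Equivalence fixes c only up to |mc| = |nC|, so the field element is determined up to sign and
-- only its square is invariant.
omit hs in
theorem toField_sq_eq_of_equivalent {t u : APTriple q} (h : t.Equivalent u) :
    t.toField s ^ 2 = u.toField s ^ 2 := by
  obtain ⟨m, n, hm, hn, h1, h2, h3⟩ := h
  have hc := t.cast_c_ne_zero (K := K)
  have hc' := u.cast_c_ne_zero (K := K)
  have hm' : (m : K) ≠ 0 := Int.cast_ne_zero.2 hm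
  have hn' : (n : K) ≠ 0 := Int.cast_ne_zero.2 hn
  have e1 : (m : K) * t.a = n * u.a := by exact_mod_cast congrArg (Int.cast : ℤ → K) h1
  have e2 : (m : K) * t.b = n * u.b := by exact_mod_cast congrArg (Int.cast : ℤ → K) h2
  have e3 : ((m : K) * t.c) ^ 2 = (n * u.c) ^ 2 := by
    exact_mod_cast congrArg (Int.cast : ℤ → K) ((sq_eq_sq_iff_abs_eq_abs _ _).2 h3)
  have e4 : (m : K) * (t.a + t.b * s) = n * (u.a + u.b * s) := by
    linear_combination e1 + s * e2
  calc t.toField s ^ 2 = (m * (t.a + t.b * s)) ^ 2 / (m * t.c) ^ 2 := by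
        rw [toField]; field_simp
    _ = (n * (u.a + u.b * s)) ^ 2 / (n * u.c) ^ 2 := by rw [e4, e3]
    _ = u.toField s ^ 2 := by rw [toField]; field_simp

end APTriple

/-! ### The divisor homomorphism and its kernel -/

namespace PAPT

section

variable {q : ℕ} (R : Type*) {K : Type*} [CommRing R] [IsDedekindDomain R] [Field K] [Algebra R K]
  [IsFractionRing R K] [CharZero K] {s : K} (hs : s ^ 2 = -q)

/-- The divisor of the norm one element attached to a class of triples. -/
noncomputable def divisorHom : PAPT q →+ (HeightOneSpectrum R →₀ ℤ) :=
  AddMonoidHom.mk' (Quotient.lift (fun t => divisor R (t.toField s)) fun t u h =>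
      divisor_eq_of_sq_eq_sq R (t.toField_ne_zero hs) (u.toField_ne_zero hs)
        (APTriple.toField_sq_eq_of_equivalent h)) fun x y => by
    induction x using ind with | h t
    induction y using ind with | h u
    change divisor R ((t.add u).toField s) = divisor R (t.toField s) + divisor R (u.toField s)
    rw [APTriple.toField_add hs, divisor_mul R (t.toField_ne_zero hs) (u.toField_ne_zero hs)]

/-- The trace of a triple whose class has trivial divisor is an integer. -/
theorem exists_two_mul_eq_of_divisorHom_eq_zero {K : Type*} [Field K] [NumberField K] {s : K}
    (hs : s ^ 2 = -q) {t : APTriple q}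
    (ht : divisorHom (NumberField.RingOfIntegers K) hs (mk t) = 0) :
    ∃ k : ℤ, 2 * t.a = k * t.c := by
  have hn : divisorHom (NumberField.RingOfIntegers K) hs (mk t.neg) = 0 := by
    rw [← neg_mk, map_neg, ht, neg_zero]
  obtain ⟨x, hx⟩ := mem_range_algebraMap_of_divisor_eq_zero _ (t.toField_ne_zero hs) ht
  obtain ⟨y, hy⟩ := mem_range_algebraMap_of_divisor_eq_zero _ (t.neg.toField_ne_zero hs) hn
  have hc := t.cast_c_ne_zero (K := K)
  -- The √-q parts cancel, so this sum of two integral elements is rational, hence an integer.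
  have hsum : algebraMap ℚ K (2 * t.a / t.c) = ((x + y : NumberField.RingOfIntegers K) : K) := by
    rw [NumberField.RingOfIntegers.coe_eq_algebraMap, map_add, hx, hy]
    simp only [APTriple.toField, APTriple.neg, map_div₀, map_mul, map_ofNat, map_intCast,
      map_natCast, Int.cast_neg]
    ring
  have hint : IsIntegral ℤ (algebraMap ℚ K (2 * t.a / t.c)) :=
    hsum ▸ NumberField.RingOfIntegers.isIntegral_coe _
  rw [isIntegral_algebraMap_iff (algebraMap ℚ K).injective] at hint
  obtain ⟨k, hk⟩ := IsIntegrallyClosed.isIntegral_iff.1 hint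
  refine ⟨k, ?_⟩
  have hc' : (t.c : ℚ) ≠ 0 := t.cast_c_ne_zero
  rw [eq_div_iff hc', eq_intCast] at hk
  exact_mod_cast hk.symm

end

theorem mk_eq_zero_of_b_eq_zero {q : ℕ} {t : APTriple q} (h : t.b = 0) : mk t = 0 := by
  rw [zero_def, mk_eq_mk]
  have he := t.eqn
  rw [h] at he
  have hc : (t.c : ℤ) ≠ 0 := by exact_mod_cast t.c_pos.ne'
  have ha : t.a ≠ 0 := fun h0 => by
    rw [h0] at he
    exact hc (pow_eq_zero_iff two_ne_zero |>.1 (by linarith))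
  refine ⟨1, t.a, one_ne_zero, ha, by simp [APTriple.one], by simp [APTriple.one, h], ?_⟩
  rw [← sq_eq_sq_iff_abs_eq_abs]
  simp only [APTriple.one]
  push_cast
  linear_combination -he

/-- If `n` times a nonzero square is a square, so is `n`. -/
theorem isSquare_of_mul_sq_eq_sq {n x y : ℤ} (hx : x ≠ 0) (h : n * x ^ 2 = y ^ 2) :
    IsSquare n := by
  have hd : x ^ 2 ∣ y ^ 2 := ⟨n, by rw [← h, mul_comm]⟩
  obtain ⟨z, rfl⟩ := (Int.pow_dvd_pow_iff two_ne_zero).1 hd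
  refine ⟨z, mul_right_cancel₀ (pow_ne_zero 2 hx) ?_⟩
  rw [h]; ring

theorem eq_one_of_squarefree_of_isSquare {q : ℕ} (hq : Squarefree q) (h : IsSquare (q : ℤ)) :
    q = 1 := by
  obtain ⟨r, rfl⟩ := Int.isSquare_natCast_iff.1 h
  rw [Nat.isUnit_iff.1 (hq r dvd_rfl)]

theorem eq_three_of_squarefree_of_isSquare {q : ℕ} (hq : Squarefree q)
    (h : IsSquare (3 * q : ℤ)) : q = 3 := by
  obtain ⟨r, hr⟩ := Int.isSquare_natCast_iff.1 (by exact_mod_cast h : IsSquare ((3 * q : ℕ) : ℤ))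
  have h3 : 3 ∣ r := by
    have : 3 ∣ r * r := ⟨q, hr.symm⟩
    exact (Nat.prime_three.dvd_mul.1 this).elim id id
  obtain ⟨u, rfl⟩ := h3
  have hq3 : q = 3 * (u * u) := by linarith
  have := Nat.isUnit_iff.1 (hq u ⟨3, by rw [hq3]; ring⟩)
  rw [hq3, this]

/-- A splitting field of X² + q serves, with no need for irreducibility. -/
theorem exists_numberField_sq_eq_neg (q : ℕ) :
    ∃ (K : Type) (_ : Field K) (_ : NumberField K) (s : K), s ^ 2 = -q := by
  let f : Polynomial ℚ := Polynomial.X ^ 2 + Polynomial.C (q : ℚ)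
  have hf : f.degree ≠ 0 := by
    rw [Polynomial.degree_X_pow_add_C two_pos]; exact two_ne_zero
  have : CharZero f.SplittingField := charZero_of_injective_algebraMap (algebraMap ℚ _).injective
  have hsp := Polynomial.SplittingField.splits f
  obtain ⟨s, hs⟩ := hsp.exists_eval_eq_zero (by rwa [Polynomial.degree_map])
  refine ⟨f.SplittingField, inferInstance, NumberField.mk, s, ?_⟩
  simp [f] at hs
  linear_combination hs

/-- A class with trivial divisor is zero, or `q = 3` and it is `[±1, ±1, 2]`. -/
theorem eq_zero_or_of_divisorHom_eq_zero {q : ℕ} (hq : Squarefree q) (h1 : q ≠ 1)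
    {K : Type*} [Field K] [NumberField K] {s : K} (hs : s ^ 2 = -q) {t : APTriple q}
    (ht : divisorHom (NumberField.RingOfIntegers K) hs (mk t) = 0) :
    mk t = 0 ∨ q = 3 ∧ (t.a = t.b ∨ t.a = -t.b) ∧ |2 * t.a| = t.c := by
  obtain ⟨k, hk⟩ := exists_two_mul_eq_of_divisorHom_eq_zero hs ht
  have he := t.eqn
  have hc : (t.c : ℤ) ≠ 0 := by exact_mod_cast t.c_pos.ne'
  have hc0 : 0 < (t.c : ℤ) := by exact_mod_cast t.c_pos
  have hmain : (q : ℤ) * (2 * t.b) ^ 2 = (4 - k ^ 2) * t.c ^ 2 := by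
    linear_combination 4 * he - (2 * t.a + k * t.c) * hk
  have hk4 : k ^ 2 ≤ 4 := by
    by_contra hlt
    have : (4 - k ^ 2) * (t.c : ℤ) ^ 2 < 0 := mul_neg_of_neg_of_pos (by linarith) (by positivity)
    have : 0 ≤ (q : ℤ) * (2 * t.b) ^ 2 := by positivity
    linarith
  by_cases hb : t.b = 0
  · exact Or.inl (mk_eq_zero_of_b_eq_zero hb)
  have hk3 : k ^ 2 = 0 ∨ k ^ 2 = 1 ∨ k ^ 2 = 4 := by
    have hl : -2 ≤ k := by nlinarith
    have hu : k ≤ 2 := by nlinarith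
    interval_cases k <;> simp
  rcases hk3 with h | h | h
  · refine absurd (eq_one_of_squarefree_of_isSquare hq
      (isSquare_of_mul_sq_eq_sq (x := t.b) (y := t.c) hb ?_)) h1
    rw [h] at hmain
    linarith
  · right
    rw [h] at hmain
    have h3 : q = 3 := eq_three_of_squarefree_of_isSquare hq
      -- Multiplying q(2b)² = 3c² by q exhibits 3q·c² as a square.
      (isSquare_of_mul_sq_eq_sq (x := t.c) (y := q * (2 * t.b)) hc
        (by linear_combination -(q : ℤ) * hmain))
    subst h3
    have hbc : (2 * t.b) ^ 2 = (t.c : ℤ) ^ 2 := by push_cast at hmain; linarith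
    have hac : (2 * t.a) ^ 2 = (t.c : ℤ) ^ 2 := by rw [hk, mul_pow, h, one_mul]
    refine ⟨rfl, sq_eq_sq_iff_eq_or_eq_neg.1 (by linarith), ?_⟩
    rw [(sq_eq_sq_iff_abs_eq_abs _ _).1 hac, abs_of_pos hc0]
  · rw [h] at hmain
    simp [hb, hq.ne_zero] at hmain

theorem mk_mem_zmultiples_omega {t : APTriple 3} (h : t.a = t.b ∨ t.a = -t.b)
    (hc : |2 * t.a| = t.c) : mk t ∈ AddSubgroup.zmultiples omega := by
  have ha : t.a ≠ 0 := by
    intro h0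
    rw [h0] at hc
    have := t.c_pos
    simp at hc
    lia
  rcases h with h | h
  · convert AddSubgroup.mem_zmultiples omega
    refine mk_eq_mk.2 ⟨1, t.a, one_ne_zero, ha, by ring, by rw [h]; ring, ?_⟩
    rw [one_mul, ← hc, abs_abs, mul_comm]; rfl
  · convert neg_mem (AddSubgroup.mem_zmultiples omega)
    refine mk_eq_mk.2 ⟨1, t.a, one_ne_zero, ha, by simp [APTriple.neg], ?_, ?_⟩
    · simp [APTriple.neg, h]
    · rw [one_mul, ← hc, abs_abs, mul_comm]; rfl

theorem addOrderOf_omega : addOrderOf omega = 3 := by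
  have : Fact (Nat.Prime 3) := ⟨Nat.prime_three⟩
  refine addOrderOf_eq_prime ?_ ?_
  · rw [succ_nsmul, two_nsmul, omega, mk_add_mk, mk_add_mk]
    exact mk_eq_zero_of_b_eq_zero (by norm_num [APTriple.add])
  · rw [omega, zero_def, Ne, mk_eq_mk]
    rintro ⟨m, n, hm, hn, -, h, -⟩
    simp [APTriple.one, hm] at h

end PAPT

/-! ### Splitting off the kernel and conclusion -/

/-- The kernel of a homomorphism to a free abelian group has a free complement. -/
theorem AddMonoidHom.exists_free_isCompl_ker {G ι : Type*} [AddCommGroup G]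
    (φ : G →+ (ι →₀ ℤ)) : ∃ F : AddSubgroup G, Module.Free ℤ F ∧ IsCompl F φ.ker := by
  let L := φ.toIntLinearMap
  have : Module.Free ℤ L.range := Finsupp.free_submodule_int _
  -- The range is free, hence projective, so a section exists; its image is the complement.
  obtain ⟨σ, hσ⟩ := L.rangeRestrict.exists_rightInverse_of_surjective L.range_rangeRestrict
  have hσ' (y : L.range) : φ (σ y) = y := congrArg Subtype.val (LinearMap.congr_fun hσ y)
  have hinj : Function.Injective σ.toAddMonoidHom := fun x y h =>
    Subtype.ext (by rw [← hσ' x, ← hσ' y]; exact congrArg φ h)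
  refine ⟨σ.toAddMonoidHom.range, Module.Free.of_equiv
    (AddMonoidHom.ofInjective hinj).toIntLinearEquiv, ?_, ?_⟩
  · rw [AddSubgroup.disjoint_def]
    rintro _ ⟨y, rfl⟩ h
    have : y = 0 := Subtype.ext ((hσ' y).symm.trans h)
    rw [this, map_zero]
  · rw [codisjoint_iff, eq_top_iff]
    intro x _
    refine AddSubgroup.mem_sup.2 ⟨σ (L.rangeRestrict x), ⟨_, rfl⟩, x - σ (L.rangeRestrict x), ?_,
      add_sub_cancel _ _⟩
    rw [AddMonoidHom.mem_ker, map_sub, hσ']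
    exact sub_self _

/-- An abelian group is the product of two complementary subgroups. -/
theorem AddSubgroup.nonempty_addEquiv_prod_of_isCompl {G : Type*} [AddCommGroup G]
    {H F : AddSubgroup G} (h : IsCompl H F) : Nonempty (G ≃+ H × F) := by
  refine ⟨(AddEquiv.ofBijective (H.subtype.coprod F.subtype) ⟨?_, ?_⟩).symm⟩
  · rw [injective_iff_map_eq_zero]
    rintro ⟨x, y⟩ hxy
    have hxy' : (x : G) + y = 0 := hxy
    have hx : (x : G) = 0 := AddSubgroup.disjoint_def.1 h.disjoint x.2
      (by rw [eq_neg_of_add_eq_zero_left hxy']; exact neg_mem y.2)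
    rw [hx, zero_add] at hxy'
    exact Prod.ext (Subtype.ext hx) (Subtype.ext hxy')
  · intro g
    obtain ⟨x, hx, y, hy, rfl⟩ := AddSubgroup.mem_sup.1 (h.sup_eq_top ▸ AddSubgroup.mem_top g)
    exact ⟨(⟨x, hx⟩, ⟨y, hy⟩), rfl⟩

theorem lemma1 :
    (∀ q : ℕ, Squarefree q → (q = 2 ∨ 3 < q) →
      IsAddTorsionFree (PAPT q) ∧ Module.Free ℤ (PAPT q)) ∧
    (AddCommGroup.torsion (PAPT 3) = AddSubgroup.zmultiples PAPT.omega ∧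
      addOrderOf PAPT.omega = 3 ∧
      ∃ F : AddSubgroup (PAPT 3), Module.Free ℤ F ∧
        IsCompl F (AddSubgroup.zmultiples PAPT.omega) ∧
        Nonempty (PAPT 3 ≃+ F × ZMod 3)) := by
  constructor
  · intro q hq hq'
    obtain ⟨K, _, _, s, hs⟩ := PAPT.exists_numberField_sq_eq_neg q
    let φ := PAPT.divisorHom (NumberField.RingOfIntegers K) hs
    have hφ : Function.Injective φ := by
      rw [injective_iff_map_eq_zero]
      intro x hx
      induction x using PAPT.ind with | h t
      exact (PAPT.eq_zero_or_of_divisorHom_eq_zero hq (by lia) hs hx).resolve_right (by lia)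
    refine ⟨hφ.isAddTorsionFree φ, ?_⟩
    have := Finsupp.free_submodule_int φ.toIntLinearMap.range
    exact Module.Free.of_equiv (LinearEquiv.ofInjective φ.toIntLinearMap hφ).symm
  · obtain ⟨K, _, _, s, hs⟩ := PAPT.exists_numberField_sq_eq_neg 3
    let φ := PAPT.divisorHom (NumberField.RingOfIntegers K) hs
    have hfin : IsOfFinAddOrder PAPT.omega :=
      addOrderOf_pos_iff.1 (by rw [PAPT.addOrderOf_omega]; exact three_pos)
    have hker_of {x : PAPT 3} (hx : IsOfFinAddOrder x) : φ x = 0 := by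
      by_contra h
      exact not_isOfFinAddOrder_of_isAddTorsionFree h (φ.isOfFinAddOrder hx)
    have hker : φ.ker = AddSubgroup.zmultiples PAPT.omega := by
      refine le_antisymm (fun x hx => ?_) ?_
      · induction x using PAPT.ind with | h t
        rcases PAPT.eq_zero_or_of_divisorHom_eq_zero Nat.prime_three.squarefree (by norm_num) hs hx
          with h | ⟨-, h1, h2⟩
        · exact h ▸ zero_mem _
        · exact PAPT.mk_mem_zmultiples_omega h1 h2
      · rw [AddSubgroup.zmultiples_le]
        exact hker_of hfin
    refine ⟨le_antisymm (fun x hx => hker ▸ hker_of hx) ?_, PAPT.addOrderOf_omega, ?_⟩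
    · rw [AddSubgroup.zmultiples_le]
      exact hfin
    · obtain ⟨F, hF, hc⟩ := φ.exists_free_isCompl_ker
      rw [hker] at hc
      obtain ⟨e⟩ := AddSubgroup.nonempty_addEquiv_prod_of_isCompl hc
      have hcard : Nat.card (AddSubgroup.zmultiples PAPT.omega) = 3 := by
        rw [Nat.card_zmultiples, PAPT.addOrderOf_omega]
      have hgen (x : AddSubgroup.zmultiples PAPT.omega) :
          x ∈ AddSubgroup.zmultiples
            (⟨PAPT.omega, AddSubgroup.mem_zmultiples _⟩ : AddSubgroup.zmultiples PAPT.omega) := by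
        obtain ⟨_, n, rfl⟩ := x
        exact ⟨n, rfl⟩
      exact ⟨F, hF, hc, ⟨e.trans ((AddEquiv.refl F).prodCongr
        (zmodAddEquivOfGenerator hgen hcard).symm)⟩⟩
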